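/- Let $k$ be a field, let $R=k[x_1,\dots,x_n]$ be graded by giving each $x_i$ degree one, and let $f_1,\dots,f_p\in R$ ($p\ge 0$) be homogeneous polynomials forming a regular sequence in $R$ (in particular $I=(f_1,\dots,f_p)\neq R$). Then $R/I$ has a minimal graded free resolution $$\cdots\to F_2\to F_1\to F_0\to R/I\to 0,\qquad F_i=\bigoplus_{j\in\mathbb Z}R(-j)^{\beta_{i,j}},$$ with every $F_i$ finitely generated, and for every such resolution the Betti diagram $\beta(R/I)=(\beta_{i,j})_{i\ge 0,\,j\in\mathbb Z}$ is a non-negative rational combination of pure diagrams of codimension $p$: there are finitely many strictly increasing integer sequences $d^{(t)}=(d^{(t)}_0<d^{(t)}_1<\dots<d^{(t)}_p)$ and rational numbers $a_t\ge 0$ such that $$\beta_{i,j}(R/I)=\sum_t a_t\,\pi(d^{(t)})_{i,j}\qquad\text{for all } i\ge 0,\ j\in\mathbb Z .$$ Here, for integers $d_0<d_1<\dots<d_p$, the pure diagram $\pi(d)$ is the matrix with $$\pi(d)_{i,d_i}=\prod_{\substack{1\le l\le p\\ l\ne i}}\frac{d_l-d_0}{|d_l-d_i|}\qquad(0\le i\le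 p)$$ (so $\pi(d)_{0,d_0}=1$), and with all other entries equal to $0$. -/

import Mathlib

namespace CIBetti

/-- The homogeneous component `R_j` of the polynomial ring `R = k[x_1, …, x_n]` with every variable
of degree one, indexed by all integers `j` (it is zero for `j < 0`). -/
def component (k : Type*) [Field k] (n : ℕ) (j : ℤ) : Submodule k (MvPolynomial (Fin n) k) where
  carrier := {g | ∀ m, g.coeff m ≠ 0 → ((m.degree : ℕ) : ℤ) = j}
  zero_mem' := by
    intro m hm
    simp at hm
  add_mem' := by
    intro a b ha hb m hm
    by_cases h : a.coeff m = 0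
    · exact hb m (by simpa [h] using hm)
    · exact ha m h
  smul_mem' := by
    intro c a ha m hm
    refine ha m fun h => hm ?_
    simp [h]

/-- The grading of `R / I` induced by the standard grading of `R`: the `j`-th piece is the image
of `R_j`. -/
noncomputable def quotientGrading {k : Type*} [Field k] {n : ℕ} (I : Ideal (MvPolynomial (Fin n) k)) (j : ℤ) :
    AddSubgroup (MvPolynomial (Fin n) k ⧸ I) :=
  (component k n j).toAddSubgroup.map (Ideal.Quotient.mk I).toAddMonoidHom

/-- A minimal graded free resolution `⋯ → F_2 → F_1 → F_0 → M → 0` over `R = k[x_1, …, x_n]` of a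
module `M` with graded pieces `ℳ j`. Here `F_i` is the free module with finite basis `ι i` in
which the basis element `b` has degree `deg i b`, that is, `F_i = ⨁_b R(-deg i b)`. -/
structure MinimalGradedFreeResolution (k : Type*) [Field k] (n : ℕ) {M : Type*} [AddCommGroup M]
    [Module (MvPolynomial (Fin n) k) M] (ℳ : ℤ → AddSubgroup M) where
  /-- The basis of `F_i`. -/
  ι : ℕ → Type
  finite_ι : ∀ i, Finite (ι i)
  /-- The degrees of the basis elements of `F_i`. -/
  deg : ∀ i, ι i → ℤ
  /-- The map `F_{i+1} → F_i`. -/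
  d : ∀ i, (ι (i + 1) →₀ MvPolynomial (Fin n) k) →ₗ[MvPolynomial (Fin n) k]
    (ι i →₀ MvPolynomial (Fin n) k)
  /-- The map `F_0 → M`. -/
  ε : (ι 0 →₀ MvPolynomial (Fin n) k) →ₗ[MvPolynomial (Fin n) k] M
  /-- The maps `F_{i+1} → F_i` preserve degrees. -/
  d_graded : ∀ i b c, d i (Finsupp.single b 1) c ∈ component k n (deg (i + 1) b - deg i c)
  /-- The map `F_0 → M` preserves degrees. -/
  ε_graded : ∀ b, ε (Finsupp.single b 1) ∈ ℳ (deg 0 b)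
  surjective_ε : Function.Surjective ε
  exact_zero : Function.Exact (d 0) ε
  exact_succ : ∀ i, Function.Exact (d (i + 1)) (d i)
  /-- Minimality: the image of `F_{i+1}` lies in `(x_1, …, x_n) F_i`. -/
  minimal : ∀ i, LinearMap.range (d i) ≤
    (Ideal.span (Set.range MvPolynomial.X) : Ideal (MvPolynomial (Fin n) k)) •
      (⊤ : Submodule (MvPolynomial (Fin n) k) (ι i →₀ MvPolynomial (Fin n) k))

/-- The graded Betti numbers `β_{i,j}`: the number of summands `R(-j)` of `F_i`. -/
noncomputable def MinimalGradedFreeResolution.bettiNumber {k : Type*} [Field k] {n : ℕ}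
    {M : Type*} [AddCommGroup M] [Module (MvPolynomial (Fin n) k) M] {ℳ : ℤ → AddSubgroup M}
    (F : MinimalGradedFreeResolution k n ℳ) (i : ℕ) (j : ℤ) : ℕ :=
  Nat.card {b : F.ι i // F.deg i b = j}

/-- The pure diagram `π(d)` of a sequence `d = (d_0, …, d_p)`. Its only possibly nonzero entries
are those at `(i, d_i)` for `0 ≤ i ≤ p`, with value `∏_{k ≠ 0, i} (d_k - d_0) / |d_k - d_i|`.
For increasing `d` and `i ≥ 1` this is `(-1)^(i+1) ∏_{k ≠ 0, i} (d_k - d_0) / (d_k - d_i)`, and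
the entry at `(0, d_0)` is `1`. -/
def pureDiagram {p : ℕ} (d : Fin (p + 1) → ℤ) (i : ℕ) (j : ℤ) : ℚ :=
  if h : i < p + 1 then
    if j = d ⟨i, h⟩ then
      ∏ l : Fin (p + 1) with l ≠ 0 ∧ l ≠ ⟨i, h⟩,
        ((d l - d 0 : ℤ) : ℚ) / ((|d l - d ⟨i, h⟩| : ℤ) : ℚ)
    else 0
  else 0

/-- `D` is a finite linear combination, with nonnegative rational coefficients, of pure diagrams
of codimension `p`, that is, of pure diagrams `π(d)` with `d_0 < d_1 < ⋯ < d_p`. -/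
def IsNonnegCombinationOfPure (p : ℕ) (D : ℕ → ℤ → ℚ) : Prop :=
  ∃ (s : ℕ) (a : Fin s → ℚ) (d : Fin s → Fin (p + 1) → ℤ),
    (∀ t, 0 ≤ a t) ∧ (∀ t, StrictMono (d t)) ∧
      ∀ i j, D i j = ∑ t, a t * pureDiagram (d t) i j

end CIBetti

/-!
The Betti numbers of `R / I` are those of the Koszul complex: `β_{i,j}` is the number of `i`-element
subsets `S` of `{1, …, p}` with `e_S = j`, where `e_a = deg f_a` and `e_S = ∑_{a ∈ S} e_a`. This has
an existence part and a uniqueness part.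

* Multiplication by `g = f_a` is injective on `R / (f_b | b < a)`, so the mapping cone of `g` on a
  minimal resolution of this ring is a resolution of the quotient by `g`; it is minimal since `g`
  lies in `(x_1, …, x_n)`. Iterating (`exists_resolution_koszul`) gives a resolution whose Betti
  numbers satisfy the recursion of `koszulNumber`.
* Two minimal resolutions are related by graded comparison maps `φ`, `ψ` with `ψ φ` homotopic to the
  identity. By minimality the homotopy vanishes modulo `(x_1, …, x_n)`, so `ψ φ` is the identity
  there, and ranks of matrices over `k` bound each Betti number of one resolution by that of the
  other (`bettiNumber_eq`).

It remains to decompose the Koszul diagram `K^U` of a finite set `U` of positive degrees. This goes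
by induction on `U`, appending the last degree `T = e_U`. Appending `T` to a pure diagram with
`d_0 = 0` multiplies its entry at `(i, j)` by `T / (T - j)`, and creates one new entry, which is
determined by the vanishing of the alternating sum of all entries of a pure diagram
(`sum_neg_one_pow_mul_pureEntry`). So appending `T` is the restriction of a linear operator
`appendDegree` on diagrams, and
`K^U = ∑_{x ∈ U} (e_x / T) • appendDegree T K^{U \ x}` (`koszulNumber_eq_sum_appendDegree`).
In the rows `i < |U|` this says that every `S ⊊ U` with `e_S = j` is counted with total weight
`∑_{x ∈ U \ S} e_x / (T - j) = 1`; in row `|U|`, it says that `∑_{S ⊆ U} (-1)^|S| = 0`.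
-/

namespace CIBetti

open MvPolynomial

variable {k : Type*} [Field k] {n : ℕ}

/-! ### Homogeneous components -/

/-- The projection of `R` onto its homogeneous component `R_j`, for an integer `j`. -/
noncomputable def proj (k : Type*) [Field k] (n : ℕ) (j : ℤ) :
    MvPolynomial (Fin n) k →ₗ[k] MvPolynomial (Fin n) k :=
  weightedHomogeneousComponent (fun _ => (1 : ℤ)) j

lemma coeff_proj (j : ℤ) (r : MvPolynomial (Fin n) k) (m : Fin n →₀ ℕ) :
    (proj k n j r).coeff m = if ((m.degree : ℕ) : ℤ) = j then r.coeff m else 0 := by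
  classical
  rw [proj, coeff_weightedHomogeneousComponent]
  have : Finsupp.weight (fun _ : Fin n => (1 : ℤ)) m = ((m.degree : ℕ) : ℤ) := by
    simp [Finsupp.weight_apply, Finsupp.degree_apply, Finsupp.sum]
  rw [this]

lemma proj_mem (j : ℤ) (r : MvPolynomial (Fin n) k) : proj k n j r ∈ component k n j := by
  intro m hm
  rw [coeff_proj] at hm
  by_contra h
  simp [h] at hm

lemma proj_of_mem {j : ℤ} {r : MvPolynomial (Fin n) k} (h : r ∈ component k n j) :
    proj k n j r = r := by
  ext m
  rw [coeff_proj]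
  split_ifs with h1
  · rfl
  · by_contra h2
    exact h1 (h m (Ne.symm h2))

lemma proj_mul {e : ℤ} {t : MvPolynomial (Fin n) k} (ht : t ∈ component k n e) (j : ℤ)
    (r : MvPolynomial (Fin n) k) : proj k n j (r * t) = proj k n (j - e) r * t := by
  classical
  ext m
  rw [coeff_proj, coeff_mul, coeff_mul]
  have key : ∀ x ∈ Finset.HasAntidiagonal.antidiagonal m,
      (proj k n (j - e) r).coeff x.1 * t.coeff x.2 =
      if ((m.degree : ℕ) : ℤ) = j then r.coeff x.1 * t.coeff x.2 else 0 := by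
    intro x hx
    rw [coeff_proj]
    by_cases h0 : t.coeff x.2 = 0
    · simp [h0]
    have h1 := ht _ h0
    have h2 : ((m.degree : ℕ) : ℤ) = (x.1.degree : ℕ) + (x.2.degree : ℕ) := by
      rw [← Finset.HasAntidiagonal.mem_antidiagonal.1 hx]
      simp [map_add]
    have h3 : ((m.degree : ℕ) : ℤ) = j ↔ ((x.1.degree : ℕ) : ℤ) = j - e := by omega
    simp [h3, ite_mul]
  rw [Finset.sum_congr rfl key]
  split_ifs <;> simp

lemma mem_component_of_isHomogeneous {r : MvPolynomial (Fin n) k} {e : ℕ}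
    (h : r.IsHomogeneous e) : r ∈ component k n e := by
  intro m hm
  rw [Finsupp.degree_eq_weight_one]
  exact_mod_cast h hm

lemma one_mem_component : (1 : MvPolynomial (Fin n) k) ∈ component k n 0 := by
  exact_mod_cast mem_component_of_isHomogeneous (isHomogeneous_one (Fin n) k)

/-- The degree-`j` part of an element of the free module `⨁_b R(-deg b)`. -/
noncomputable def freeProj {α : Type*} (deg : α → ℤ) (j : ℤ) (x : α →₀ MvPolynomial (Fin n) k) :
    α →₀ MvPolynomial (Fin n) k :=
  Finsupp.onFinset x.support (fun b => proj k n (j - deg b) (x b)) fun b hb => by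
    rw [Finsupp.mem_support_iff]
    intro h
    exact hb (by rw [h, map_zero])

@[simp] lemma freeProj_apply {α : Type*} (deg : α → ℤ) (j : ℤ) (x : α →₀ MvPolynomial (Fin n) k)
    (b : α) : freeProj deg j x b = proj k n (j - deg b) (x b) := rfl

/-- A functional on `⨁_b R(-deg b)` that lowers degrees by `c` commutes with taking homogeneous
parts. -/
lemma map_freeProj {α : Type*} {deg : α → ℤ} {c : ℤ}
    (T : (α →₀ MvPolynomial (Fin n) k) →ₗ[MvPolynomial (Fin n) k] MvPolynomial (Fin n) k)
    (hT : ∀ b, T (Finsupp.single b 1) ∈ component k n (deg b - c)) (j : ℤ)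
    (x : α →₀ MvPolynomial (Fin n) k) : T (freeProj deg j x) = proj k n (j - c) (T x) := by
  induction x using Finsupp.induction_linear with
  | zero =>
    have : freeProj deg j (0 : α →₀ MvPolynomial (Fin n) k) = 0 := by ext1 b; simp
    rw [this, map_zero, map_zero]
  | add x y hx hy =>
    have : freeProj deg j (x + y) = freeProj deg j x + freeProj deg j y := by ext1 b; simp
    rw [this, map_add, map_add, map_add, hx, hy]
  | single b r =>
    have h1 : freeProj deg j (Finsupp.single b r) =
        proj k n (j - deg b) r • Finsupp.single b (1 : MvPolynomial (Fin n) k) := by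
      classical
      ext1 b'
      by_cases h : b = b'
      · subst h; simp
      · simp [Finsupp.single_eq_of_ne' h]
    have h2 : Finsupp.single b r = r • Finsupp.single b (1 : MvPolynomial (Fin n) k) := by simp
    rw [h1, h2, map_smul, map_smul, smul_eq_mul, smul_eq_mul, proj_mul (hT b)]
    congr 3
    ring

/-- The degree-`j` part of the free module `⨁_b R(-deg b)`. -/
def IsFreeHomogeneous {α : Type*} (deg : α → ℤ) (j : ℤ) (x : α →₀ MvPolynomial (Fin n) k) : Prop :=
  ∀ b, x b ∈ component k n (j - deg b)

/-- A linear map of free modules of degree zero. -/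
def IsGradedMap {α β : Type*} (degα : α → ℤ) (degβ : β → ℤ)
    (T : (α →₀ MvPolynomial (Fin n) k) →ₗ[MvPolynomial (Fin n) k]
      (β →₀ MvPolynomial (Fin n) k)) : Prop :=
  ∀ b, IsFreeHomogeneous degβ (degα b) (T (Finsupp.single b 1))

lemma isFreeHomogeneous_freeProj {α : Type*} (deg : α → ℤ) (j : ℤ)
    (x : α →₀ MvPolynomial (Fin n) k) : IsFreeHomogeneous deg j (freeProj deg j x) :=
  fun _ => proj_mem _ _

lemma IsFreeHomogeneous.freeProj_eq {α : Type*} {deg : α → ℤ} {j : ℤ}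
    {x : α →₀ MvPolynomial (Fin n) k} (hx : IsFreeHomogeneous deg j x) : freeProj deg j x = x := by
  ext1 b
  exact proj_of_mem (hx b)

variable {α β : Type*} {degα : α → ℤ} {degβ : β → ℤ}
  {T : (α →₀ MvPolynomial (Fin n) k) →ₗ[MvPolynomial (Fin n) k] (β →₀ MvPolynomial (Fin n) k)}

lemma IsGradedMap.map_freeProj (hT : IsGradedMap degα degβ T) (j : ℤ)
    (x : α →₀ MvPolynomial (Fin n) k) : T (freeProj degα j x) = freeProj degβ j (T x) := by
  ext1 c
  exact CIBetti.map_freeProj (Finsupp.lapply c ∘ₗ T) (fun b => hT b c) j x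

lemma IsGradedMap.isFreeHomogeneous (hT : IsGradedMap degα degβ T) {j : ℤ}
    {x : α →₀ MvPolynomial (Fin n) k} (hx : IsFreeHomogeneous degα j x) :
    IsFreeHomogeneous degβ j (T x) := by
  rw [← hx.freeProj_eq, hT.map_freeProj]
  exact isFreeHomogeneous_freeProj _ _ _

lemma IsGradedMap.exists_homogeneous_preimage (hT : IsGradedMap degα degβ T) {j : ℤ}
    {y : β →₀ MvPolynomial (Fin n) k} (hy : IsFreeHomogeneous degβ j y)
    (h : y ∈ LinearMap.range T) : ∃ x, IsFreeHomogeneous degα j x ∧ T x = y := by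
  obtain ⟨x, rfl⟩ := h
  exact ⟨freeProj degα j x, isFreeHomogeneous_freeProj _ _ _,
    by rw [hT.map_freeProj, hy.freeProj_eq]⟩

/-! ### Minimal resolutions and uniqueness of Betti numbers -/

lemma constantCoeff_eq_zero_of_mem {r : MvPolynomial (Fin n) k}
    (h : r ∈ (Ideal.span (Set.range X) : Ideal (MvPolynomial (Fin n) k))) :
    constantCoeff r = 0 := by
  rw [← RingHom.mem_ker]
  refine Ideal.span_le.2 ?_ h
  rintro _ ⟨i, rfl⟩
  simp

lemma mem_span_X_of_constantCoeff_eq_zero {r : MvPolynomial (Fin n) k}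
    (h : constantCoeff r = 0) :
    r ∈ (Ideal.span (Set.range X) : Ideal (MvPolynomial (Fin n) k)) := by
  rw [← Set.image_univ, mem_ideal_span_X_image]
  intro m hm
  by_contra! h1
  have : m = 0 := by ext i; simpa using h1 i
  subst this
  exact mem_support_iff.1 hm h

/-- Membership in `(x_1, …, x_n) F` for a free module `F`, tested on coordinates. -/
lemma mem_maximal_smul_top_iff {x : α →₀ MvPolynomial (Fin n) k} :
    x ∈ (Ideal.span (Set.range X) : Ideal (MvPolynomial (Fin n) k)) •
      (⊤ : Submodule (MvPolynomial (Fin n) k) (α →₀ MvPolynomial (Fin n) k)) ↔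
    ∀ b, constantCoeff (x b) = 0 := by
  constructor
  · intro h b
    refine Submodule.smul_induction_on h (fun r hr y _ => ?_) (fun x y hx hy => ?_)
    · simp [constantCoeff_eq_zero_of_mem hr]
    · simp [hx, hy]
  · intro h
    rw [← Finsupp.sum_single x]
    refine Submodule.sum_mem _ fun b _ => ?_
    have : Finsupp.single b (x b) = x b • Finsupp.single b (1 : MvPolynomial (Fin n) k) := by simp
    rw [this]
    exact Submodule.smul_mem_smul (mem_span_X_of_constantCoeff_eq_zero (h b)) trivial

lemma constantCoeff_map_eq_zero
    (T : (α →₀ MvPolynomial (Fin n) k) →ₗ[MvPolynomial (Fin n) k] (β →₀ MvPolynomial (Fin n) k))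
    {x : α →₀ MvPolynomial (Fin n) k} (hx : ∀ b, constantCoeff (x b) = 0) (c : β) :
    constantCoeff (T x c) = 0 := by
  refine mem_maximal_smul_top_iff.1 ?_ c
  have h := Submodule.mem_map_of_mem (f := T) (mem_maximal_smul_top_iff.2 hx)
  rw [Submodule.map_smul''] at h
  exact Submodule.smul_mono le_rfl le_top h

lemma constantCoeff_eq_zero_of_mem_component {r : MvPolynomial (Fin n) k} {e : ℤ}
    (h : r ∈ component k n e) (he : e ≠ 0) : constantCoeff r = 0 := by
  by_contra h1
  exact he (by simpa using (h 0 h1).symm)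

/-- For a graded map `ε` from a graded free module to a module `M` with pieces `ℳ j`, if `ε x` lies
in `ℳ j` then the degree-`j` part of `x` has the same image as `x`. This replaces the requirement
that the pieces `ℳ j` form a grading of `M`. -/
def HasHomogeneousLifts (k : Type*) [Field k] (n : ℕ) {M : Type*} [AddCommGroup M]
    [Module (MvPolynomial (Fin n) k) M] (ℳ : ℤ → AddSubgroup M) : Prop :=
  ∀ (α : Type) (deg : α → ℤ) (ε : (α →₀ MvPolynomial (Fin n) k) →ₗ[MvPolynomial (Fin n) k] M),
    (∀ b, ε (Finsupp.single b 1) ∈ ℳ (deg b)) → ∀ j, ∀ x, ε x ∈ ℳ j →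
      ε (freeProj deg j x) = ε x

namespace MinimalGradedFreeResolution

variable {M : Type*} [AddCommGroup M] [Module (MvPolynomial (Fin n) k) M] {ℳ : ℤ → AddSubgroup M}

/-- Graded comparison map between two resolutions of the same module. -/
lemma exists_comparison (hℳ : HasHomogeneousLifts k n ℳ) (F G : MinimalGradedFreeResolution k n ℳ) :
    ∃ φ : ∀ i, (F.ι i →₀ MvPolynomial (Fin n) k) →ₗ[MvPolynomial (Fin n) k]
        (G.ι i →₀ MvPolynomial (Fin n) k),
      (∀ i, IsGradedMap (F.deg i) (G.deg i) (φ i)) ∧ (∀ x, G.ε (φ 0 x) = F.ε x) ∧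
        ∀ i x, G.d i (φ (i + 1) x) = φ i (F.d i x) := by
  classical
  have base : ∃ φ : (F.ι 0 →₀ MvPolynomial (Fin n) k) →ₗ[MvPolynomial (Fin n) k]
      (G.ι 0 →₀ MvPolynomial (Fin n) k), IsGradedMap (F.deg 0) (G.deg 0) φ ∧
        ∀ x, G.ε (φ x) = F.ε x := by
    choose y hy using fun b => G.surjective_ε (F.ε (Finsupp.single b 1))
    refine ⟨Finsupp.linearCombination _ fun b => freeProj (G.deg 0) (F.deg 0 b) (y b),
      fun b => ?_, ?_⟩
    · rw [Finsupp.linearCombination_single, one_smul]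
      exact isFreeHomogeneous_freeProj _ _ _
    · intro x
      rw [← LinearMap.comp_apply]
      refine LinearMap.congr_fun (Finsupp.lhom_ext' fun b => LinearMap.ext_ring ?_) x
      simp only [LinearMap.comp_apply, Finsupp.lsingle_apply, Finsupp.linearCombination_single,
        one_smul]
      rw [hℳ _ _ _ G.ε_graded _ _ (by rw [hy]; exact F.ε_graded b), hy]
  have step : ∀ i (φ : (F.ι i →₀ MvPolynomial (Fin n) k) →ₗ[MvPolynomial (Fin n) k]
      (G.ι i →₀ MvPolynomial (Fin n) k)), IsGradedMap (F.deg i) (G.deg i) φ →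
      (∀ x, φ (F.d i x) ∈ LinearMap.range (G.d i)) →
      ∃ ψ : (F.ι (i + 1) →₀ MvPolynomial (Fin n) k) →ₗ[MvPolynomial (Fin n) k]
      (G.ι (i + 1) →₀ MvPolynomial (Fin n) k), IsGradedMap (F.deg (i + 1)) (G.deg (i + 1)) ψ ∧
        (∀ x, ψ (F.d (i + 1) x) ∈ LinearMap.range (G.d (i + 1))) ∧
        ∀ x, G.d i (ψ x) = φ (F.d i x) := by
    intro i φ hφ hr
    have hG : IsGradedMap (G.deg (i + 1)) (G.deg i) (G.d i) := G.d_graded i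
    have hF : IsGradedMap (F.deg (i + 1)) (F.deg i) (F.d i) := F.d_graded i
    choose y hy1 hy2 using fun b => hG.exists_homogeneous_preimage
      (hφ.isFreeHomogeneous (hF b)) (hr (Finsupp.single b 1))
    have comm : ∀ x, G.d i (Finsupp.linearCombination (MvPolynomial (Fin n) k) y x) =
        φ (F.d i x) := by
      intro x
      rw [← LinearMap.comp_apply, ← LinearMap.comp_apply]
      refine LinearMap.congr_fun (Finsupp.lhom_ext' fun b => LinearMap.ext_ring ?_) x
      simp [hy2]
    refine ⟨Finsupp.linearCombination _ y, fun b => ?_, fun x => ?_, comm⟩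
    · simpa using hy1 b
    · rw [LinearMap.mem_range]
      refine (G.exact_succ i _).1 ?_
      rw [comm, (F.exact_succ i _).2 ⟨x, rfl⟩, map_zero]
  obtain ⟨φ₀, h0, h0'⟩ := base
  choose S hS1 hS2 hS3 using step
  let Φ : ∀ i, {φ : (F.ι i →₀ MvPolynomial (Fin n) k) →ₗ[MvPolynomial (Fin n) k]
      (G.ι i →₀ MvPolynomial (Fin n) k) // IsGradedMap (F.deg i) (G.deg i) φ ∧
      ∀ x, φ (F.d i x) ∈ LinearMap.range (G.d i)} := fun i =>
    Nat.rec ⟨φ₀, h0, fun x => (G.exact_zero _).1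
        (by rw [h0']; exact (F.exact_zero _).2 ⟨x, rfl⟩)⟩
      (fun i φ => ⟨S i φ.1 φ.2.1 φ.2.2, hS1 _ _ _ _, hS2 _ _ _ _⟩) i
  exact ⟨fun i => (Φ i).1, fun i => (Φ i).2.1, h0', fun i x => hS3 _ _ _ _ x⟩

/-- An endomorphism of a minimal resolution lifting the identity is the identity modulo
`(x_1, …, x_n)`: it is homotopic to the identity, and the homotopy terms `d h + h d` vanish modulo
`(x_1, …, x_n)` by minimality. -/
lemma constantCoeff_endomorphism (F : MinimalGradedFreeResolution k n ℳ)
    (θ : ∀ i, (F.ι i →₀ MvPolynomial (Fin n) k) →ₗ[MvPolynomial (Fin n) k]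
        (F.ι i →₀ MvPolynomial (Fin n) k))
    (h0 : ∀ x, F.ε (θ 0 x) = F.ε x) (hθ : ∀ i x, F.d i (θ (i + 1) x) = θ i (F.d i x))
    (i : ℕ) (x : F.ι i →₀ MvPolynomial (Fin n) k) (c : F.ι i) :
    constantCoeff (θ i x c) = constantCoeff (x c) := by
  classical
  -- `lift T` is the projectivity of the free module `F_i`
  have lift : ∀ i (T : (F.ι i →₀ MvPolynomial (Fin n) k) →ₗ[MvPolynomial (Fin n) k]
      (F.ι i →₀ MvPolynomial (Fin n) k)), (∀ x, T x ∈ LinearMap.range (F.d i)) →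
      ∃ h : (F.ι i →₀ MvPolynomial (Fin n) k) →ₗ[MvPolynomial (Fin n) k]
        (F.ι (i + 1) →₀ MvPolynomial (Fin n) k), ∀ x, F.d i (h x) = T x := by
    intro i T hT
    choose y hy using fun b => hT (Finsupp.single b 1)
    refine ⟨Finsupp.linearCombination _ y, fun x => ?_⟩
    rw [← LinearMap.comp_apply]
    refine LinearMap.congr_fun (Finsupp.lhom_ext' fun b => LinearMap.ext_ring ?_) x
    simp [hy]
  have hd : ∀ i x c, constantCoeff (F.d i x c) = 0 := fun i x =>
    mem_maximal_smul_top_iff.1 (F.minimal i ⟨x, rfl⟩)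
  have key : ∀ i, ∃ h : (F.ι i →₀ MvPolynomial (Fin n) k) →ₗ[MvPolynomial (Fin n) k]
        (F.ι (i + 1) →₀ MvPolynomial (Fin n) k),
      (∀ x c, constantCoeff ((θ i x - x - F.d i (h x)) c) = 0) ∧
      ∀ x, θ i (F.d i x) - F.d i x - F.d i (h (F.d i x)) = 0 := by
    intro i
    induction i with
    | zero =>
      obtain ⟨h, hh⟩ := lift 0 (θ 0 - LinearMap.id) fun x => (F.exact_zero _).1 (by simp [h0])
      exact ⟨h, fun x c => by simp [hh], fun x => by simp [hh]⟩
    | succ i ih =>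
      obtain ⟨h, h1, h2⟩ := ih
      obtain ⟨h', hh⟩ := lift (i + 1) (θ (i + 1) - LinearMap.id - h ∘ₗ F.d i) fun x =>
        (F.exact_succ i _).1 (by simpa [hθ] using h2 x)
      refine ⟨h', fun x c => ?_, fun x => ?_⟩
      · simpa [hh] using constantCoeff_map_eq_zero h (hd i x) c
      · have : F.d i (F.d (i + 1) x) = 0 := (F.exact_succ i _).2 ⟨x, rfl⟩
        simp [hh, this]
  obtain ⟨h, h1, -⟩ := key i
  have := h1 x c
  simp only [Finsupp.sub_apply, map_sub, hd, sub_zero] at this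
  exact sub_eq_zero.1 this

lemma bettiNumber_le (hℳ : HasHomogeneousLifts k n ℳ) (F G : MinimalGradedFreeResolution k n ℳ)
    (i : ℕ) (j : ℤ) : F.bettiNumber i j ≤ G.bettiNumber i j := by
  classical
  obtain ⟨φ, hφ, hφ0, hφd⟩ := exists_comparison hℳ F G
  obtain ⟨ψ, hψ, hψ0, hψd⟩ := exists_comparison hℳ G F
  have key := F.constantCoeff_endomorphism (fun i => ψ i ∘ₗ φ i) (by simp [hφ0, hψ0])
    (by simp [hφd, hψd]) i
  have := F.finite_ι i
  have := G.finite_ι i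
  have := Fintype.ofFinite (F.ι i)
  have := Fintype.ofFinite (G.ι i)
  -- the matrices over `k` of the degree-`j` parts of `φ i` and `ψ i` modulo `(x_1, …, x_n)`
  let A : Matrix {b // F.deg i b = j} {c // G.deg i c = j} k := fun b c =>
    constantCoeff (φ i (Finsupp.single b.1 1) c.1)
  let B : Matrix {c // G.deg i c = j} {b // F.deg i b = j} k := fun c b =>
    constantCoeff (ψ i (Finsupp.single c.1 1) b.1)
  have hAB : A * B = 1 := by
    ext b b'
    have h1 := key (Finsupp.single b.1 1) b'.1
    rw [LinearMap.comp_apply] at h1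
    have h2 : ψ i (φ i (Finsupp.single b.1 1)) b'.1 =
        ∑ c, φ i (Finsupp.single b.1 1) c * ψ i (Finsupp.single c 1) b'.1 := by
      conv_lhs => rw [← Finsupp.sum_single (φ i (Finsupp.single b.1 1)),
        Finsupp.sum_fintype _ _ (by simp), map_sum, Finsupp.finsetSum_apply]
      refine Finset.sum_congr rfl fun c _ => ?_
      rw [← mul_one (φ i (Finsupp.single b.1 1) c), ← smul_eq_mul, ← Finsupp.smul_single,
        map_smul]
      simp
    have h3 : ∑ c, constantCoeff (φ i (Finsupp.single b.1 1) c * ψ i (Finsupp.single c 1) b'.1) =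
        ∑ c : {c // G.deg i c = j}, A b c * B c b' := by
      simp only [A, B, ← map_mul]
      refine (Fintype.sum_of_injective Subtype.val Subtype.val_injective _ _ (fun c hc => ?_)
        fun _ => rfl).symm
      have hc' : G.deg i c ≠ j := by simpa using hc
      rw [map_mul, constantCoeff_eq_zero_of_mem_component (hφ i b.1 c), zero_mul]
      rw [b.2]
      exact sub_ne_zero.2 hc'.symm
    rw [Matrix.mul_apply, ← h3, ← map_sum, ← h2, h1, Matrix.one_apply]
    by_cases h : b = b'
    · subst h; simp
    · rw [if_neg h, Finsupp.single_eq_of_ne' (fun h' => h (Subtype.ext h')), map_zero]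
  rw [bettiNumber, bettiNumber, Nat.card_eq_fintype_card, Nat.card_eq_fintype_card,
    ← Matrix.rank_one (R := k) (n := {b // F.deg i b = j}), ← hAB]
  exact (Matrix.rank_mul_le_left A B).trans (Matrix.rank_le_card_width A)

/-- All minimal graded free resolutions of a module have the same Betti numbers. -/
theorem bettiNumber_eq (hℳ : HasHomogeneousLifts k n ℳ) (F G : MinimalGradedFreeResolution k n ℳ)
    (i : ℕ) (j : ℤ) : F.bettiNumber i j = G.bettiNumber i j :=
  le_antisymm (bettiNumber_le hℳ F G i j) (bettiNumber_le hℳ G F i j)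

end MinimalGradedFreeResolution

/-! ### Gradings on quotients of `R` -/

lemma mem_quotientGrading {I : Ideal (MvPolynomial (Fin n) k)} {j : ℤ}
    {y : MvPolynomial (Fin n) k ⧸ I} :
    y ∈ quotientGrading I j ↔ ∃ r ∈ component k n j, Ideal.Quotient.mk I r = y := by
  rfl

/-- If `I` is stable under taking homogeneous components, so is the image in `R / I`. -/
lemma hasHomogeneousLifts_quotientGrading {I : Ideal (MvPolynomial (Fin n) k)}
    (hI : ∀ j, ∀ r ∈ I, proj k n j r ∈ I) : HasHomogeneousLifts k n (quotientGrading I) := by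
  intro α deg ε hε j x hx
  choose u hu1 hu2 using fun b => mem_quotientGrading.1 (hε b)
  obtain ⟨r, hr, hrx⟩ := mem_quotientGrading.1 hx
  have hU : ∀ x, ε x = Ideal.Quotient.mk I (Finsupp.linearCombination _ u x) := by
    intro x
    change ε x = ((Ideal.Quotient.mkₐ (MvPolynomial (Fin n) k) I).toLinearMap ∘ₗ
      Finsupp.linearCombination _ u) x
    refine LinearMap.congr_fun (Finsupp.lhom_ext' fun b => LinearMap.ext_ring ?_) x
    simp [hu2]
  have h1 : Finsupp.linearCombination _ u x - r ∈ I := by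
    rw [← Ideal.Quotient.eq, ← hU, hrx]
  have h2 := hI j _ h1
  rw [map_sub, proj_of_mem hr] at h2
  have h3 := map_freeProj (c := 0) (deg := deg) (Finsupp.linearCombination _ u)
    (fun b => by simpa using hu1 b) j x
  rw [sub_zero] at h3
  rw [hU, h3, ← hrx]
  exact Ideal.Quotient.eq.2 h2

lemma proj_mem_span {α : Type*} [Fintype α] {f : α → MvPolynomial (Fin n) k} {e : α → ℤ}
    (hf : ∀ a, f a ∈ component k n (e a)) (j : ℤ) {r : MvPolynomial (Fin n) k}
    (hr : r ∈ Ideal.span (Set.range f)) : proj k n j r ∈ Ideal.span (Set.range f) := by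
  obtain ⟨c, rfl⟩ := Ideal.mem_span_range_iff_exists_fun.1 hr
  rw [map_sum]
  refine Submodule.sum_mem _ fun a _ => ?_
  rw [proj_mul (hf a)]
  exact Ideal.mul_mem_left _ _ (Ideal.subset_span ⟨a, rfl⟩)

/-! ### Mapping cones -/

/-- The index types of the bases of the mapping cone of an endomorphism. -/
def ConeIndex (ι : ℕ → Type) : ℕ → Type
  | 0 => ι 0
  | i + 1 => ι (i + 1) ⊕ ι i

/-- The degrees of the basis elements of the mapping cone of an endomorphism of degree `e`. -/
def coneDeg {ι : ℕ → Type} (deg : ∀ i, ι i → ℤ) (e : ℤ) : ∀ i, ConeIndex ι i → ℤ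
  | 0 => deg 0
  | i + 1 => Sum.elim (deg (i + 1)) (fun b => deg i b + e)

section cone

variable {R : Type*} [CommRing R] {ι : ℕ → Type}

/-- The degree-zero part of the mapping cone is `F_0`. -/
noncomputable def coneSplitZero (R : Type*) [CommRing R] (ι : ℕ → Type) :
    (ConeIndex ι 0 →₀ R) ≃ₗ[R] (ι 0 →₀ R) :=
  LinearEquiv.refl R (ι 0 →₀ R)

/-- The degree-`(i + 1)` part of the mapping cone is `F_{i + 1} ⊕ F_i`. -/
noncomputable def coneSplit (R : Type*) [CommRing R] (ι : ℕ → Type) (i : ℕ) :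
    (ConeIndex ι (i + 1) →₀ R) ≃ₗ[R] (ι (i + 1) →₀ R) × (ι i →₀ R) :=
  Finsupp.sumFinsuppLEquivProdFinsupp R

lemma coneSplit_symm_single_zero (i : ℕ) (b : ι (i + 1)) :
    (coneSplit R ι i).symm (Finsupp.single b 1, 0) =
      (Finsupp.single (Sum.inl b : ι (i + 1) ⊕ ι i) 1 : ConeIndex ι (i + 1) →₀ R) :=
  Finsupp.sumElim_single_zero b 1

lemma coneSplit_symm_zero_single (i : ℕ) (b : ι i) :
    (coneSplit R ι i).symm (0, Finsupp.single b 1) =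
      Finsupp.single (Sum.inr b : ι (i + 1) ⊕ ι i) 1 :=
  Finsupp.sumElim_zero_single b 1

/-- The differential of the mapping cone of multiplication by `g`: it is
`(a, b) ↦ (d a + g b, - d b)`, where the component `- d b` is absent for `b` in `F_0`. -/
noncomputable def coneMap (d : ∀ i, (ι (i + 1) →₀ R) →ₗ[R] (ι i →₀ R)) (g : R) :
    ∀ i, (ConeIndex ι (i + 1) →₀ R) →ₗ[R] (ConeIndex ι i →₀ R)
  | 0 => (coneSplitZero R ι).symm.toLinearMap ∘ₗ ((d 0).coprod (g • LinearMap.id)) ∘ₗ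
      (coneSplit R ι 0).toLinearMap
  | i + 1 => (coneSplit R ι i).symm.toLinearMap ∘ₗ
      (((d (i + 1)).coprod (g • LinearMap.id)).prod (-(d i ∘ₗ LinearMap.snd R _ _))) ∘ₗ
      (coneSplit R ι (i + 1)).toLinearMap

variable (d : ∀ i, (ι (i + 1) →₀ R) →ₗ[R] (ι i →₀ R)) (g : R)

lemma coneMap_zero_apply (a : ι 1 →₀ R) (b : ι 0 →₀ R) :
    coneMap d g 0 ((coneSplit R ι 0).symm (a, b)) = (coneSplitZero R ι).symm (d 0 a + g • b) := by
  simp [coneMap]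

lemma coneMap_succ_apply (i : ℕ) (a : ι (i + 2) →₀ R) (b : ι (i + 1) →₀ R) :
    coneMap d g (i + 1) ((coneSplit R ι (i + 1)).symm (a, b)) =
      (coneSplit R ι i).symm (d (i + 1) a + g • b, -d i b) := by
  simp [coneMap]

variable {d g} {N : Type*} [AddCommGroup N] [Module R N] {ε : (ι 0 →₀ R) →ₗ[R] N}

lemma exact_coneMap_zero (h0 : Function.Exact (d 0) ε) (h : ∀ i, Function.Exact (d (i + 1)) (d i))
    (hg : ∀ y : N, g • y = 0 → y = 0) : Function.Exact (coneMap d g 1) (coneMap d g 0) := by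
  intro x
  obtain ⟨⟨a, b⟩, rfl⟩ := (coneSplit R ι 0).symm.surjective x
  rw [coneMap_zero_apply, LinearEquiv.map_eq_zero_iff]
  constructor
  · intro hab
    have h1 : g • ε b = 0 := by
      rw [← map_smul, eq_neg_of_add_eq_zero_right hab, map_neg, (h0 _).2 ⟨a, rfl⟩, neg_zero]
    obtain ⟨b', rfl⟩ := (h0 _).1 (hg _ h1)
    obtain ⟨a', ha'⟩ := (h 0 (a + g • b')).1 (by simpa using hab)
    refine ⟨(coneSplit R ι 1).symm (a', -b'), ?_⟩
    rw [coneMap_succ_apply, ha']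
    simp
  · rintro ⟨y, hy⟩
    obtain ⟨⟨a', b'⟩, rfl⟩ := (coneSplit R ι 1).symm.surjective y
    rw [coneMap_succ_apply] at hy
    obtain ⟨rfl, rfl⟩ := Prod.ext_iff.1 ((coneSplit R ι 0).symm.injective hy)
    have := (h 0 _).2 ⟨a', rfl⟩
    simp_all

lemma exact_coneMap_succ (h : ∀ i, Function.Exact (d (i + 1)) (d i)) (i : ℕ) :
    Function.Exact (coneMap d g (i + 2)) (coneMap d g (i + 1)) := by
  intro x
  obtain ⟨⟨a, b⟩, rfl⟩ := (coneSplit R ι (i + 1)).symm.surjective x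
  rw [coneMap_succ_apply, LinearEquiv.map_eq_zero_iff, Prod.mk_eq_zero, neg_eq_zero]
  constructor
  · rintro ⟨hab, hb⟩
    obtain ⟨b', rfl⟩ := (h i _).1 hb
    obtain ⟨a', ha'⟩ := (h (i + 1) (a + g • b')).1 (by simpa using hab)
    refine ⟨(coneSplit R ι (i + 2)).symm (a', -b'), ?_⟩
    rw [coneMap_succ_apply, ha']
    simp
  · rintro ⟨y, hy⟩
    obtain ⟨⟨a', b'⟩, rfl⟩ := (coneSplit R ι (i + 2)).symm.surjective y
    rw [coneMap_succ_apply] at hy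
    obtain ⟨rfl, rfl⟩ := Prod.ext_iff.1 ((coneSplit R ι (i + 1)).symm.injective hy)
    have h1 := (h (i + 1) _).2 ⟨a', rfl⟩
    have h2 := (h i _).2 ⟨b', rfl⟩
    simp_all

end cone

/-- If `g` is regular on `R / I` and homogeneous of nonzero degree, the mapping cone of
multiplication by `g` on a minimal graded free resolution of `R / I` is one of `R / (I + (g))`. -/
noncomputable def MinimalGradedFreeResolution.cone {I J : Ideal (MvPolynomial (Fin n) k)}
    (F : MinimalGradedFreeResolution k n (quotientGrading I)) {g : MvPolynomial (Fin n) k} {e : ℤ}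
    (hg : g ∈ component k n e) (he : e ≠ 0) (hreg : ∀ r, g * r ∈ I → r ∈ I)
    (hJ : J = I ⊔ Ideal.span {g}) : MinimalGradedFreeResolution k n (quotientGrading J) where
  ι := ConeIndex F.ι
  finite_ι i := by
    have := F.finite_ι
    cases i
    · exact this 0
    · exact inferInstanceAs (Finite (_ ⊕ _))
  deg := coneDeg F.deg e
  d := coneMap F.d g
  ε := (Ideal.Quotient.factorₐ (MvPolynomial (Fin n) k)
      (hJ ▸ le_sup_left : I ≤ J)).toLinearMap ∘ₗ F.ε ∘ₗ (coneSplitZero _ F.ι).toLinearMap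
  d_graded i b c := by
    have hg0 : ∀ i (b c : F.ι i), (g • Finsupp.single b (1 : MvPolynomial (Fin n) k)) c ∈
        component k n (F.deg i b + e - F.deg i c) := by
      intro i b c
      by_cases h : b = c
      · subst h; simpa using hg
      · simp [Finsupp.single_eq_of_ne' h]
    have hmem : ∀ {x y : MvPolynomial (Fin n) k} {j : ℤ}, x = y → y ∈ component k n j →
        x ∈ component k n j := fun h hy => h ▸ hy
    cases i with
    | zero =>
      rcases b with b | b
      · have h := coneMap_zero_apply F.d g (Finsupp.single b 1) 0
        rw [smul_zero, add_zero] at h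
        exact hmem (DFunLike.congr_fun
          ((congrArg _ (coneSplit_symm_single_zero 0 b).symm).trans h) c) (F.d_graded 0 b c)
      · have h := coneMap_zero_apply F.d g 0 (Finsupp.single b 1)
        rw [map_zero, zero_add (g • _)] at h
        exact hmem (DFunLike.congr_fun
          ((congrArg _ (coneSplit_symm_zero_single 0 b).symm).trans h) c) (hg0 0 b c)
    | succ i =>
      rcases b with b | b
      · have h := coneMap_succ_apply F.d g i (Finsupp.single b 1) 0
        rw [smul_zero, add_zero, map_zero, neg_zero] at h
        have h' := DFunLike.congr_fun
          ((congrArg _ (coneSplit_symm_single_zero (i + 1) b).symm).trans h) c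
        rcases c with c | c
        · exact hmem h' (F.d_graded (i + 1) b c)
        · exact hmem h' (Submodule.zero_mem _)
      · have h := coneMap_succ_apply F.d g i 0 (Finsupp.single b 1)
        rw [map_zero, zero_add (g • _)] at h
        have h' := DFunLike.congr_fun
          ((congrArg _ (coneSplit_symm_zero_single (i + 1) b).symm).trans h) c
        rcases c with c | c
        · exact hmem h' (hg0 (i + 1) b c)
        · have h1 := (component k n _).neg_mem (F.d_graded i b c)
          have h2 : F.deg (i + 1) b - F.deg i c = F.deg (i + 1) b + e - (F.deg i c + e) := by ring
          rw [h2] at h1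
          exact hmem h' h1
  ε_graded b := by
    obtain ⟨r, hr, h⟩ := mem_quotientGrading.1 (F.ε_graded b)
    refine mem_quotientGrading.2 ⟨r, hr, ?_⟩
    change _ = Ideal.Quotient.factorₐ (MvPolynomial (Fin n) k) (hJ ▸ le_sup_left : I ≤ J)
      (F.ε (Finsupp.single b 1))
    rw [← h]
    rfl
  surjective_ε := by
    have h : I ≤ J := hJ ▸ le_sup_left
    exact (Ideal.Quotient.factor_surjective h).comp
      (F.surjective_ε.comp (coneSplitZero _ F.ι).surjective)
  exact_zero := by
    intro x
    obtain ⟨x, rfl⟩ := (coneSplitZero _ F.ι).symm.surjective x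
    have hIJ : I ≤ J := hJ ▸ le_sup_left
    have hgJ : g ∈ J := hJ ▸ Ideal.mem_sup_right (Ideal.mem_span_singleton_self g)
    simp only [LinearMap.comp_apply, LinearEquiv.coe_coe, LinearEquiv.apply_symm_apply,
      AlgHom.toLinearMap_apply]
    constructor
    · intro hx
      obtain ⟨r, hr⟩ := Ideal.Quotient.mk_surjective (F.ε x)
      rw [← hr, Ideal.Quotient.factorₐ_apply_mk, Ideal.Quotient.eq_zero_iff_mem, hJ] at hx
      obtain ⟨s, hs, t, ht, rfl⟩ := Submodule.mem_sup.1 hx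
      obtain ⟨u, rfl⟩ := Ideal.mem_span_singleton.1 ht
      obtain ⟨y, hy⟩ := F.surjective_ε (Ideal.Quotient.mk I u)
      have h1 : F.ε (x - g • y) = 0 := by
        rw [map_sub, map_smul, hy, ← hr, map_add, Ideal.Quotient.eq_zero_iff_mem.2 hs, zero_add,
          sub_eq_zero]
        rfl
      obtain ⟨z, hz⟩ := (F.exact_zero _).1 h1
      refine ⟨(coneSplit _ F.ι 0).symm (z, y), ?_⟩
      rw [coneMap_zero_apply, hz, sub_add_cancel]
    · rintro ⟨y, hy⟩
      obtain ⟨⟨a, b⟩, rfl⟩ := (coneSplit _ F.ι 0).symm.surjective y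
      rw [coneMap_zero_apply] at hy
      rw [← (coneSplitZero _ F.ι).symm.injective hy, map_add, (F.exact_zero _).2 ⟨a, rfl⟩,
        zero_add, map_smul]
      obtain ⟨r, hr⟩ := Ideal.Quotient.mk_surjective (F.ε b)
      rw [← hr]
      change Ideal.Quotient.mk J (g * r) = 0
      exact Ideal.Quotient.eq_zero_iff_mem.2 (J.mul_mem_right _ hgJ)
  exact_succ i := by
    cases i with
    | zero =>
      refine exact_coneMap_zero F.exact_zero F.exact_succ fun y hy => ?_
      obtain ⟨r, rfl⟩ := Ideal.Quotient.mk_surjective y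
      rw [Ideal.Quotient.eq_zero_iff_mem]
      exact hreg r (Ideal.Quotient.eq_zero_iff_mem.1 hy)
    | succ i => exact exact_coneMap_succ F.exact_succ i
  minimal i := by
    have hd : ∀ i x c, constantCoeff (F.d i x c) = 0 := fun i x =>
      mem_maximal_smul_top_iff.1 (F.minimal i ⟨x, rfl⟩)
    rintro _ ⟨x, rfl⟩
    obtain ⟨⟨a, b⟩, rfl⟩ := (coneSplit _ F.ι i).symm.surjective x
    rw [mem_maximal_smul_top_iff]
    intro c
    cases i with
    | zero =>
      rw [coneMap_zero_apply]
      have h : ∀ c, constantCoeff ((F.d 0 a + g • b) c) = 0 := fun c => by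
        simp [hd, constantCoeff_eq_zero_of_mem_component hg he]
      exact h c
    | succ i =>
      rw [coneMap_succ_apply]
      rcases c with c | c
      · change constantCoeff ((F.d (i + 1) a + g • b) c) = 0
        simp [hd, constantCoeff_eq_zero_of_mem_component hg he]
      · change constantCoeff ((-F.d i b) c) = 0
        simp [hd]

lemma MinimalGradedFreeResolution.bettiNumber_cone_zero {I J : Ideal (MvPolynomial (Fin n) k)}
    (F : MinimalGradedFreeResolution k n (quotientGrading I)) {g : MvPolynomial (Fin n) k} {e : ℤ}
    (hg : g ∈ component k n e) (he : e ≠ 0) (hreg : ∀ r, g * r ∈ I → r ∈ I)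
    (hJ : J = I ⊔ Ideal.span {g}) (j : ℤ) :
    (F.cone hg he hreg hJ).bettiNumber 0 j = F.bettiNumber 0 j := rfl

lemma MinimalGradedFreeResolution.bettiNumber_cone_succ {I J : Ideal (MvPolynomial (Fin n) k)}
    (F : MinimalGradedFreeResolution k n (quotientGrading I)) {g : MvPolynomial (Fin n) k} {e : ℤ}
    (hg : g ∈ component k n e) (he : e ≠ 0) (hreg : ∀ r, g * r ∈ I → r ∈ I)
    (hJ : J = I ⊔ Ideal.span {g}) (i : ℕ) (j : ℤ) :
    (F.cone hg he hreg hJ).bettiNumber (i + 1) j =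
      F.bettiNumber (i + 1) j + F.bettiNumber i (j - e) := by
  have := F.finite_ι i
  have := F.finite_ι (i + 1)
  have h : {b // F.deg i b = j - e} ≃ {b // F.deg i b + e = j} :=
    Equiv.subtypeEquivRight fun b => eq_sub_iff_add_eq
  rw [bettiNumber, bettiNumber, bettiNumber, Nat.card_congr h, ← Nat.card_sum]
  exact Nat.card_congr (Equiv.subtypeSum (p := fun b => coneDeg F.deg e (i + 1) b = j))

/-! ### The resolution of a complete intersection -/

/-- The polynomial ring as its own resolution. -/
noncomputable def trivialResolution (k : Type*) [Field k] (n : ℕ)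
    {I : Ideal (MvPolynomial (Fin n) k)} (hI : I = ⊥) :
    MinimalGradedFreeResolution k n (quotientGrading I) where
  ι i := {_u : Unit // i = 0}
  finite_ι _ := inferInstance
  deg _ _ := 0
  d _ := 0
  ε := Finsupp.linearCombination _ fun _ => 1
  d_graded _ _ _ := Submodule.zero_mem _
  ε_graded b := mem_quotientGrading.2 ⟨1, one_mem_component, by simp⟩
  surjective_ε y := by
    obtain ⟨r, rfl⟩ := Ideal.Quotient.mk_surjective y
    refine ⟨Finsupp.single ⟨(), rfl⟩ r, ?_⟩
    rw [Finsupp.linearCombination_single]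
    exact mul_one (Ideal.Quotient.mk I r)
  exact_zero x := by
    obtain ⟨r, rfl⟩ : ∃ r, x = Finsupp.single ⟨(), rfl⟩ r :=
      ⟨x ⟨(), rfl⟩, by ext1 ⟨b, hb⟩; simp⟩
    have : Finsupp.linearCombination (MvPolynomial (Fin n) k)
        (fun _ : {_u : Unit // 0 = 0} => (1 : MvPolynomial (Fin n) k ⧸ I))
        (Finsupp.single ⟨(), rfl⟩ r) = Ideal.Quotient.mk I r := by
      rw [Finsupp.linearCombination_single]
      exact mul_one (Ideal.Quotient.mk I r)
    rw [this, Ideal.Quotient.eq_zero_iff_mem, hI]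
    simp [eq_comm (a := (0 : _ →₀ MvPolynomial (Fin n) k))]
  exact_succ i x := by
    have : Subsingleton ({_u : Unit // i + 1 = 0} →₀ MvPolynomial (Fin n) k) :=
      ⟨fun x y => by ext1 b; exact absurd b.2 (by simp)⟩
    simp [Subsingleton.elim x 0]
  minimal i := by simp

/-- The number of subsets of `U` of size `i` and weight `j`: a graded Betti number of the Koszul
complex. -/
def koszulNumber {α : Type*} (e : α → ℤ) (U : Finset α) (i : ℕ) (j : ℤ) : ℕ :=
  (U.powerset.filter fun S => S.card = i ∧ ∑ a ∈ S, e a = j).card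

lemma koszulNumber_empty {α : Type*} (e : α → ℤ) (i : ℕ) (j : ℤ) :
    koszulNumber e ∅ i j = if i = 0 ∧ j = 0 then 1 else 0 := by
  simp only [koszulNumber, Finset.powerset_empty, Finset.filter_singleton, Finset.card_empty,
    Finset.sum_empty, eq_comm (a := 0) (b := i), eq_comm (a := 0) (b := j)]
  split_ifs <;> rfl

lemma koszulNumber_insert_zero {α : Type*} [DecidableEq α] (e : α → ℤ) {U : Finset α} {a : α}
    (j : ℤ) : koszulNumber e (insert a U) 0 j = koszulNumber e U 0 j := by
  unfold koszulNumber
  congr 1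
  ext S
  simp only [Finset.mem_filter, Finset.mem_powerset, Finset.card_eq_zero]
  constructor <;> (rintro ⟨-, rfl, h⟩; simpa using h)

lemma koszulNumber_insert_succ {α : Type*} [DecidableEq α] (e : α → ℤ) {U : Finset α} {a : α}
    (ha : a ∉ U) (i : ℕ) (j : ℤ) : koszulNumber e (insert a U) (i + 1) j =
      koszulNumber e U (i + 1) j + koszulNumber e U i (j - e a) := by
  unfold koszulNumber
  rw [Finset.powerset_insert, Finset.filter_union, Finset.card_union_of_disjoint]
  · congr 1
    rw [Finset.filter_image, Finset.card_image_of_injOn]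
    · congr 1
      refine Finset.filter_congr fun S hS => ?_
      have haS : a ∉ S := fun h => ha (Finset.mem_powerset.1 hS h)
      rw [Finset.card_insert_of_notMem haS, Finset.sum_insert haS, eq_sub_iff_add_eq',
        add_left_inj]
    · intro S hS T hT h
      have haS : a ∉ S := fun h => ha (Finset.mem_powerset.1 (Finset.mem_filter.1 hS).1 h)
      have haT : a ∉ T := fun h => ha (Finset.mem_powerset.1 (Finset.mem_filter.1 hT).1 h)
      rw [← Finset.erase_insert haS, h, Finset.erase_insert haT]
  · rw [Finset.disjoint_left]
    intro S hS hS'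
    obtain ⟨T, -, rfl⟩ := Finset.mem_image.1 (Finset.mem_filter.1 hS').1
    exact ha (Finset.mem_powerset.1 (Finset.mem_filter.1 hS).1 (Finset.mem_insert_self _ _))

/-- Iterating the mapping cone over a regular sequence of forms gives a minimal resolution with the
Betti numbers of the Koszul complex. -/
theorem exists_resolution_koszul {p : ℕ} (f : Fin p → MvPolynomial (Fin n) k) (e : Fin p → ℤ)
    (hf : ∀ a, f a ∈ component k n (e a)) (he : ∀ a, e a ≠ 0)
    (hreg : ∀ a r, f a * r ∈ Ideal.span (f '' {b | b < a}) → r ∈ Ideal.span (f '' {b | b < a})) :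
    ∃ F : MinimalGradedFreeResolution k n (quotientGrading (Ideal.span (Set.range f))),
      ∀ i j, F.bettiNumber i j = koszulNumber e Finset.univ i j := by
  have key : ∀ m ≤ p, ∀ I, I = Ideal.span (f '' {b | (b : ℕ) < m}) →
      ∃ F : MinimalGradedFreeResolution k n (quotientGrading I),
        ∀ i j, F.bettiNumber i j = koszulNumber e {b | (b : ℕ) < m} i j := by
    intro m
    induction m with
    | zero =>
      intro _ I hI
      have hI : I = ⊥ := by simp [hI]
      refine ⟨trivialResolution k n hI, fun i j => ?_⟩
      have : (({b | (b : ℕ) < 0} : Finset (Fin p))) = ∅ := by simp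
      rw [this, koszulNumber_empty]
      change Nat.card {b : {_u : Unit // i = 0} // (0 : ℤ) = j} = _
      by_cases hi : i = 0 <;> by_cases hj : 0 = j
      · simp [hi, hj]
      · simp [hi, hj, Ne.symm hj]
      · simp [hi, hj]
      · simp [hi, hj]
    | succ m ih =>
      intro hm J hJ
      obtain ⟨F, hF⟩ := ih (by omega) _ rfl
      let a : Fin p := ⟨m, hm⟩
      have hset : {b : Fin p | (b : ℕ) < m + 1} = {b : Fin p | (b : ℕ) < m} ∪ {a} := by
        ext b
        simp [a, Fin.ext_iff]
        omega
      have hfin : ({b | (b : ℕ) < m + 1} : Finset (Fin p)) =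
          insert a ({b | (b : ℕ) < m} : Finset (Fin p)) := by
        ext b
        simp [a, Fin.ext_iff]
        omega
      have ha : a ∉ ({b | (b : ℕ) < m} : Finset (Fin p)) := by simp [a]
      rw [hset, Set.image_union, Set.image_singleton, Ideal.span_union] at hJ
      refine ⟨F.cone (hf a) (he a) (hreg a) hJ, fun i j => ?_⟩
      rw [hfin]
      cases i with
      | zero => rw [koszulNumber_insert_zero, F.bettiNumber_cone_zero, hF]
      | succ i => rw [koszulNumber_insert_succ e ha, F.bettiNumber_cone_succ, hF, hF]
  obtain ⟨F, hF⟩ := key p le_rfl (Ideal.span (Set.range f)) (by simp)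
  exact ⟨F, by simpa using hF⟩

/-- Weak regularity of a sequence in terms of membership in the ideals generated by its initial
segments. -/
lemma mul_mem_span_of_isWeaklyRegular {R : Type*} [CommRing R] {p : ℕ} {f : Fin p → R}
    (h : RingTheory.Sequence.IsWeaklyRegular R (List.ofFn f)) (a : Fin p) (r : R)
    (hr : f a * r ∈ Ideal.span (f '' {b | b < a})) : r ∈ Ideal.span (f '' {b | b < a}) := by
  have h1 := h.regular_mod_prev a (by simp)
  have h2 : (Ideal.ofList ((List.ofFn f).take a) • ⊤ : Submodule R R) =
      Ideal.span (f '' {b | b < a}) := by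
    rw [smul_eq_mul, Ideal.mul_top, Ideal.ofList]
    congr 1
    ext x
    simp only [Set.mem_ofPred_eq, List.mem_take_iff_getElem, List.length_ofFn, List.getElem_ofFn,
      Set.mem_image]
    constructor
    · rintro ⟨i, hi, rfl⟩
      exact ⟨⟨i, by omega⟩, Fin.lt_def.2 (by simp; omega), rfl⟩
    · rintro ⟨b, hb, rfl⟩
      exact ⟨b, by have := Fin.lt_def.1 hb; omega, rfl⟩
  rw [h2, List.getElem_ofFn] at h1
  rw [← Ideal.Quotient.eq_zero_iff_mem] at hr ⊢
  refine h1 ?_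
  simp only [smul_zero]
  exact hr

end CIBetti

namespace CIBetti

open Finset

/-! ### Pure diagrams -/

/-- The nonzero entry of `π(d)` in row `i`. -/
def pureEntry {p : ℕ} (d : Fin (p + 1) → ℤ) (i : Fin (p + 1)) : ℚ :=
  ∏ l : Fin (p + 1) with l ≠ 0 ∧ l ≠ i, ((d l - d 0 : ℤ) : ℚ) / ((|d l - d i| : ℤ) : ℚ)

lemma pureDiagram_of_lt {p : ℕ} (d : Fin (p + 1) → ℤ) {i : ℕ} (hi : i < p + 1) (j : ℤ) :
    pureDiagram d i j = if j = d ⟨i, hi⟩ then pureEntry d ⟨i, hi⟩ else 0 := by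
  rw [pureDiagram, dif_pos hi]
  rfl

lemma pureDiagram_of_le {p : ℕ} (d : Fin (p + 1) → ℤ) {i : ℕ} (hi : p + 1 ≤ i) (j : ℤ) :
    pureDiagram d i j = 0 := by
  rw [pureDiagram, dif_neg (by omega)]

lemma pureEntry_eq_div {p : ℕ} {d : Fin (p + 1) → ℤ} (hd : StrictMono d) (i : Fin (p + 1)) :
    pureEntry d i = (∏ l ∈ univ.erase 0, ((d l : ℚ) - d 0)) /
      ∏ l ∈ univ.erase i, |(d l : ℚ) - d i| := by
  have h1 : pureEntry d i = (∏ l ∈ (univ.erase 0).erase i, ((d l : ℚ) - d 0)) /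
      ∏ l ∈ (univ.erase 0).erase i, |(d l : ℚ) - d i| := by
    rw [← prod_div_distrib, pureEntry]
    refine prod_congr ?_ fun l _ => by push_cast; rfl
    ext l
    simp [and_comm]
  rw [h1]
  by_cases hi : i = 0
  · subst hi
    rw [erase_idem]
  · have h0 : 0 < (d i : ℚ) - d 0 := by
      rw [sub_pos]
      exact_mod_cast hd (Fin.pos_iff_ne_zero.2 hi)
    have h2 : (d i : ℚ) - d 0 = |(d 0 : ℚ) - d i| := by rw [abs_sub_comm, abs_of_pos h0]
    rw [← mul_prod_erase (univ.erase 0) _ (by simpa using hi),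
      ← mul_prod_erase (univ.erase i) (fun l => |(d l : ℚ) - d i|) (a := 0)
        (by simpa using Ne.symm hi), erase_right_comm, ← h2, mul_div_mul_left _ _ h0.ne']

lemma prod_abs_sub {p : ℕ} {d : Fin (p + 1) → ℤ} (hd : StrictMono d) (i : Fin (p + 1)) :
    ∏ l ∈ univ.erase i, |(d l : ℚ) - d i| =
      (-1) ^ (p - (i : ℕ)) * ∏ l ∈ univ.erase i, ((d i : ℚ) - d l) := by
  have h1 : ∏ l ∈ univ.erase i, (if i < l then (-1 : ℚ) else 1) = (-1) ^ (p - (i : ℕ)) := by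
    rw [prod_erase _ (by simp), prod_ite, prod_const, prod_const_one, mul_one]
    congr 1
    rw [Finset.filter_lt_eq_Ioi, Fin.card_Ioi]
    simp
  rw [← h1, ← prod_mul_distrib]
  refine prod_congr rfl fun l hl => ?_
  rcases lt_or_gt_of_ne (ne_of_mem_erase hl) with h | h
  · have : (d l : ℚ) < d i := by exact_mod_cast hd h
    rw [if_neg h.not_gt, abs_of_neg (by linarith)]
    ring
  · have : (d i : ℚ) < d l := by exact_mod_cast hd h
    rw [if_pos h, abs_of_pos (by linarith)]
    ring

/-- The Herzog–Kühl equation of a pure diagram: the alternating sum of its entries vanishes. Up to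
a common factor, these are the reciprocals `∏_{l ≠ i} (d_i - d_l)⁻¹` of Lagrange interpolation. -/
lemma sum_neg_one_pow_mul_pureEntry {p : ℕ} {d : Fin (p + 2) → ℤ} (hd : StrictMono d) :
    ∑ i : Fin (p + 2), (-1 : ℚ) ^ (i : ℕ) * pureEntry d i = 0 := by
  have hinj : Set.InjOn (fun l => (d l : ℚ)) (univ : Finset (Fin (p + 2))) :=
    fun a _ b _ h => hd.injective (Int.cast_injective h)
  have h := Lagrange.coeff_eq_sum (P := (1 : Polynomial ℚ)) hinj (by
    rw [Polynomial.degree_one, card_univ, Fintype.card_fin]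
    exact_mod_cast Nat.succ_pos (p + 1))
  rw [Polynomial.coeff_one, if_neg (by simp)] at h
  have key : ∀ i : Fin (p + 2), (-1 : ℚ) ^ (i : ℕ) * pureEntry d i =
      ((-1) ^ (p + 1) * ∏ l ∈ univ.erase 0, ((d l : ℚ) - d 0)) *
        (Polynomial.eval (d i : ℚ) 1 / ∏ l ∈ univ.erase i, ((d i : ℚ) - d l)) := by
    intro i
    have hs : (-1 : ℚ) ^ (p + 1) = (-1) ^ (i : ℕ) * (-1) ^ (p + 1 - (i : ℕ)) := by
      rw [← pow_add]
      congr 1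
      omega
    have h1 : ((-1 : ℚ) ^ (p + 1 - (i : ℕ)))⁻¹ = (-1) ^ (p + 1 - (i : ℕ)) := by
      rw [← inv_pow]
      norm_num
    rw [pureEntry_eq_div hd, prod_abs_sub hd, hs, Polynomial.eval_one, div_eq_mul_inv, mul_inv, h1]
    ring
  rw [sum_congr rfl fun i _ => key i, ← mul_sum, ← h, mul_zero]

lemma strictMono_snoc {p : ℕ} {d : Fin (p + 1) → ℤ} (hd : StrictMono d) {T : ℤ}
    (hT : d (Fin.last p) < T) : StrictMono (Fin.snoc d T : Fin (p + 2) → ℤ) := by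
  rw [Fin.strictMono_iff_lt_succ]
  intro i
  induction i using Fin.lastCases with
  | last => simpa using hT
  | cast i =>
    rw [Fin.succ_castSucc, Fin.snoc_castSucc, Fin.snoc_castSucc]
    exact hd (Fin.castSucc_lt_succ)

lemma pureEntry_snoc_castSucc {p : ℕ} {d : Fin (p + 1) → ℤ} (hd : StrictMono d) (h0 : d 0 = 0)
    {T : ℤ} (hT : d (Fin.last p) < T) (i : Fin (p + 1)) :
    pureEntry (Fin.snoc d T : Fin (p + 2) → ℤ) i.castSucc =
      pureEntry d i * (T / (T - d i)) := by
  have hi : d i < T := (hd.monotone (Fin.le_last i)).trans_lt hT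
  have h1 : (Fin.snoc d T : Fin (p + 2) → ℤ) 0 = 0 := by
    rw [← Fin.castSucc_zero, Fin.snoc_castSucc, h0]
  have h2 : |T - d i| = T - d i := abs_of_pos (by omega)
  rw [pureEntry, prod_filter, Fin.prod_univ_castSucc, pureEntry, prod_filter, h1, h0]
  simp only [Fin.snoc_castSucc, Fin.snoc_last, h2]
  congr 1
  · refine prod_congr rfl fun l _ => ?_
    simp
  · rw [if_pos ⟨Fin.last_pos.ne', (Fin.castSucc_lt_last i).ne'⟩]
    simp

lemma pureEntry_snoc_last {p : ℕ} {d : Fin (p + 1) → ℤ} (hd : StrictMono d) (h0 : d 0 = 0)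
    {T : ℤ} (hT : d (Fin.last p) < T) :
    pureEntry (Fin.snoc d T : Fin (p + 2) → ℤ) (Fin.last (p + 1)) =
      (-1) ^ p * ∑ i : Fin (p + 1), (-1) ^ (i : ℕ) * (pureEntry d i * (T / (T - d i))) := by
  have h := sum_neg_one_pow_mul_pureEntry (strictMono_snoc hd hT)
  rw [Fin.sum_univ_castSucc] at h
  simp only [pureEntry_snoc_castSucc hd h0 hT, Fin.val_castSucc, Fin.val_last] at h
  have h1 : (-1 : ℚ) ^ p * (-1) ^ p = 1 := by rw [← mul_pow]; norm_num
  have h2 := congrArg ((-1 : ℚ) ^ p * ·) (eq_neg_of_add_eq_zero_left h)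
  rw [h2, pow_succ]
  linear_combination (-pureEntry (Fin.snoc d T : Fin (p + 2) → ℤ) (Fin.last (p + 1))) * h1

/-- The linear operator on diagrams that sends `π(d_0, …, d_p)`, with `d_0 = 0`, to
`π(d_0, …, d_p, T)`. The last entry is determined by the vanishing of the alternating sum. -/
noncomputable def appendDegree (p : ℕ) (T : ℤ) : (ℕ → ℤ → ℚ) →ₗ[ℚ] (ℕ → ℤ → ℚ) where
  toFun D i j :=
    if i ≤ p then D i j * (T / (T - j))
    else if i = p + 1 ∧ j = T then
      (-1) ^ p * ∑ i ∈ range (p + 1), (-1) ^ i * ∑ j ∈ Ico 0 T, D i j * ((T : ℚ) / (T - j))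
    else 0
  map_add' D E := by
    ext i j
    simp only [Pi.add_apply, add_mul, sum_add_distrib, mul_add]
    split_ifs <;> simp
  map_smul' c D := by
    ext i j
    simp only [Pi.smul_apply, smul_eq_mul, RingHom.id_apply, mul_sum, mul_ite, mul_zero]
    split_ifs
    · ring
    · refine sum_congr rfl fun i _ => sum_congr rfl fun j _ => by ring
    · rfl

lemma appendDegree_pureDiagram {p : ℕ} {d : Fin (p + 1) → ℤ} (hd : StrictMono d) (h0 : d 0 = 0)
    {T : ℤ} (hT : d (Fin.last p) < T) :
    appendDegree p T (pureDiagram d) = pureDiagram (Fin.snoc d T : Fin (p + 2) → ℤ) := by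
  ext i j
  change (if i ≤ p then _ else if i = p + 1 ∧ j = T then _ else _) = _
  split_ifs with hi hij
  · have h1 : (⟨i, by omega⟩ : Fin (p + 2)) = Fin.castSucc ⟨i, by omega⟩ := rfl
    rw [pureDiagram_of_lt _ (by omega), pureDiagram_of_lt _ (by omega), h1, Fin.snoc_castSucc,
      pureEntry_snoc_castSucc hd h0 hT]
    split_ifs with h
    · rw [h]
    · simp
  · obtain ⟨rfl, rfl⟩ := hij
    have h1 : (⟨p + 1, by omega⟩ : Fin (p + 2)) = Fin.last (p + 1) := rfl
    rw [pureDiagram_of_lt _ (by omega), h1, Fin.snoc_last, if_pos rfl,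
      pureEntry_snoc_last hd h0 hT, sum_range]
    congr 1
    refine sum_congr rfl fun i _ => ?_
    congr 1
    have hi0 : 0 ≤ d i := h0 ▸ hd.monotone (Fin.zero_le i)
    have hi : d i < j := (hd.monotone (Fin.le_last i)).trans_lt hT
    rw [sum_eq_single (d i)]
    · rw [pureDiagram_of_lt _ i.2, if_pos rfl]
    · intro b _ hb
      rw [pureDiagram_of_lt _ i.2, if_neg hb, zero_mul]
    · intro h
      exact absurd (mem_Ico.2 ⟨hi0, hi⟩) h
  · by_cases hi' : i = p + 1
    · subst hi'
      rw [pureDiagram_of_lt _ (by omega), if_neg]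
      have h1 : (⟨p + 1, by omega⟩ : Fin (p + 2)) = Fin.last (p + 1) := rfl
      rw [h1, Fin.snoc_last]
      simpa using hij
    · rw [pureDiagram_of_le _ (by omega)]

/-- The cone spanned by the pure diagrams of codimension `p` with `d_0 = 0` and `d_p = w`. -/
def pureCone (p : ℕ) (w : ℤ) : Submodule ℚ≥0 (ℕ → ℤ → ℚ) :=
  Submodule.span ℚ≥0 {D | ∃ d : Fin (p + 1) → ℤ, StrictMono d ∧ d 0 = 0 ∧ d (Fin.last p) = w ∧
    pureDiagram d = D}

lemma appendDegree_mem_pureCone {p : ℕ} {w T : ℤ} (hT : w < T) {D : ℕ → ℤ → ℚ}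
    (hD : D ∈ pureCone p w) : appendDegree p T D ∈ pureCone (p + 1) T := by
  refine Submodule.map_span_le ((appendDegree p T).restrictScalars ℚ≥0) _ _ |>.2 ?_
    (Submodule.mem_map_of_mem hD)
  rintro _ ⟨d, hd, h0, rfl, rfl⟩
  refine Submodule.subset_span ⟨Fin.snoc d T, strictMono_snoc hd hT, ?_, Fin.snoc_last _ _,
    (appendDegree_pureDiagram hd h0 hT).symm⟩
  rw [← Fin.castSucc_zero, Fin.snoc_castSucc, h0]

lemma isNonnegCombinationOfPure_of_mem_pureCone {p : ℕ} {w : ℤ} {D : ℕ → ℤ → ℚ}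
    (hD : D ∈ pureCone p w) : IsNonnegCombinationOfPure p D := by
  obtain ⟨s, a, g, rfl⟩ := Submodule.mem_span_set'.1 hD
  choose d hd _ _ hg using fun t => (g t).2
  refine ⟨s, fun t => a t, d, fun t => (a t).2, hd, fun i j => ?_⟩
  simp only [Finset.sum_apply, Pi.smul_apply, ← hg]
  rfl

/-! ### The Betti diagram of a complete intersection -/

section koszul

variable {α : Type*} {e : α → ℤ}

lemma koszulNumber_eq_sum (U : Finset α) (i : ℕ) (j : ℤ) :
    (koszulNumber e U i j : ℤ) =
      ∑ S ∈ U.powerset, if S.card = i ∧ ∑ a ∈ S, e a = j then 1 else 0 := by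
  rw [koszulNumber, card_filter]
  push_cast
  rfl

/-- Counting pairs `x ∉ S ⊆ U`, weighted by `e x`. -/
lemma sum_mul_koszulNumber_erase [DecidableEq α] (U : Finset α) (i : ℕ) (j : ℤ) :
    ∑ x ∈ U, e x * koszulNumber e (U.erase x) i j = (∑ x ∈ U, e x - j) * koszulNumber e U i j := by
  have h1 : ∀ x ∈ U, e x * koszulNumber e (U.erase x) i j =
      ∑ S ∈ U.powerset, if S.card = i ∧ ∑ a ∈ S, e a = j then
        (if x ∉ S then e x else 0) else 0 := by
    intro x _
    have h2 : (U.erase x).powerset = U.powerset.filter fun S => x ∉ S := by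
      ext S
      simp [subset_erase]
    rw [koszulNumber_eq_sum, h2, sum_filter, mul_sum]
    refine sum_congr rfl fun S _ => ?_
    split_ifs <;> simp
  rw [sum_congr rfl h1, sum_comm, koszulNumber_eq_sum, mul_sum]
  refine sum_congr rfl fun S hS => ?_
  split_ifs with h
  · rw [← sum_filter, ← sdiff_eq_filter, sum_sdiff_eq_sub (mem_powerset.1 hS), h.2, mul_one]
  · simp

lemma koszulNumber_eq_zero_of_sum (he : ∀ a, 0 < e a) {U : Finset α} {i : ℕ} (hi : i ≠ U.card) :
    koszulNumber e U i (∑ a ∈ U, e a) = 0 := by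
  rw [koszulNumber, card_eq_zero, filter_eq_empty_iff]
  rintro S hS ⟨rfl, h⟩
  have hlt : S ⊂ U := (mem_powerset.1 hS).ssubset_of_ne fun h' => hi (by rw [h'])
  obtain ⟨a, haU, haS⟩ := exists_of_ssubset hlt
  exact h.not_lt (sum_lt_sum_of_subset hlt.1 haU haS (he a) fun b _ _ => (he b).le)

lemma koszulNumber_card {U : Finset α} (j : ℤ) :
    koszulNumber e U U.card j = if j = ∑ a ∈ U, e a then 1 else 0 := by
  have h : (U.powerset.filter fun S => S.card = U.card ∧ ∑ a ∈ S, e a = j) =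
      if j = ∑ a ∈ U, e a then {U} else ∅ := by
    ext S
    simp only [mem_filter, mem_powerset]
    constructor
    · rintro ⟨hS, hc, rfl⟩
      rw [eq_of_subset_of_card_le hS hc.ge]
      simp
    · split_ifs with h
      · intro hS
        rw [mem_singleton.1 hS]
        exact ⟨Subset.rfl, rfl, h.symm⟩
      · simp
  rw [koszulNumber, h]
  split_ifs <;> simp

lemma koszulNumber_of_card_lt {U : Finset α} {i : ℕ} (hi : U.card < i) (j : ℤ) :
    koszulNumber e U i j = 0 := by
  rw [koszulNumber, card_eq_zero, filter_eq_empty_iff]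
  rintro S hS ⟨rfl, -⟩
  exact hi.not_ge (card_le_card (mem_powerset.1 hS))

lemma alternating_sum_koszulNumber [DecidableEq α] (he : ∀ a, 0 < e a) {U : Finset α} {p : ℕ}
    (hU : U.card = p + 1) :
    ∑ i ∈ range (p + 1), (-1 : ℤ) ^ i * ∑ j ∈ Ico 0 (∑ a ∈ U, e a), (koszulNumber e U i j : ℤ) =
      (-1) ^ p := by
  have h1 : ∀ S ∈ U.powerset, S ≠ U → ∑ i ∈ range (p + 1), ∑ j ∈ Ico 0 (∑ a ∈ U, e a),
      (if S.card = i ∧ ∑ a ∈ S, e a = j then (-1 : ℤ) ^ i else 0) = (-1) ^ S.card := by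
    intro S hS hne
    have hlt : S ⊂ U := (mem_powerset.1 hS).ssubset_of_ne hne
    obtain ⟨a, haU, haS⟩ := exists_of_ssubset hlt
    have hsum := sum_lt_sum_of_subset hlt.1 haU haS (he a) fun b _ _ => (he b).le
    have hc := card_lt_card hlt
    rw [sum_eq_single S.card, sum_eq_single (∑ a ∈ S, e a)]
    · simp
    · rintro b - hb
      rw [if_neg (fun h => hb h.2.symm)]
    · intro h
      exact absurd (mem_Ico.2 ⟨sum_nonneg fun b _ => (he b).le, hsum⟩) h
    · rintro b - hb
      exact sum_eq_zero fun j _ => if_neg (fun h => hb h.1.symm)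
    · intro h
      exact absurd (mem_range.2 (by omega)) h
  have h2 : ∑ i ∈ range (p + 1), ∑ j ∈ Ico 0 (∑ a ∈ U, e a),
      (if U.card = i ∧ ∑ a ∈ U, e a = j then (-1 : ℤ) ^ i else 0) = 0 := by
    refine sum_eq_zero fun i hi => sum_eq_zero fun j _ => if_neg fun h => ?_
    have := mem_range.1 hi
    omega
  have h3 : ∑ i ∈ range (p + 1), (-1 : ℤ) ^ i * ∑ j ∈ Ico 0 (∑ a ∈ U, e a),
      (koszulNumber e U i j : ℤ) = ∑ S ∈ U.powerset, ∑ i ∈ range (p + 1),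
        ∑ j ∈ Ico 0 (∑ a ∈ U, e a),
        (if S.card = i ∧ ∑ a ∈ S, e a = j then (-1 : ℤ) ^ i else 0) := by
    rw [sum_comm]
    refine sum_congr rfl fun i _ => ?_
    rw [sum_comm, mul_sum]
    refine sum_congr rfl fun j _ => ?_
    rw [koszulNumber_eq_sum, mul_sum]
    exact sum_congr rfl fun S _ => by simp
  have h4 := Finset.sum_powerset_neg_one_pow_card (x := U)
  rw [if_neg (by rintro rfl; simp at hU),
    ← add_sum_erase _ _ (mem_powerset_self U), hU, pow_succ] at h4
  rw [h3, ← add_sum_erase _ _ (mem_powerset_self U), h2, zero_add,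
    sum_congr rfl fun S hS => h1 S (mem_of_mem_erase hS) (ne_of_mem_erase hS)]
  linarith

/-- The Koszul diagram of `U` is the average, with weights `e x / e_U`, of the diagrams obtained
from the Koszul diagrams of `U \ {x}` by appending the degree `e_U`. -/
lemma koszulNumber_eq_sum_appendDegree [DecidableEq α] (he : ∀ a, 0 < e a) {U : Finset α} {p : ℕ}
    (hU : U.card = p + 1) :
    (fun i j => (koszulNumber e U i j : ℚ)) = ∑ x ∈ U, ((e x : ℚ) / (∑ a ∈ U, e a : ℤ)) •
      appendDegree p (∑ a ∈ U, e a) (fun i j => (koszulNumber e (U.erase x) i j : ℚ)) := by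
  set T := ∑ a ∈ U, e a with hT
  have hTpos : 0 < T := sum_pos (fun a _ => he a) (card_pos.1 (by omega))
  have hT0 : (T : ℚ) ≠ 0 := by exact_mod_cast hTpos.ne'
  -- the entries in rows at most `p`
  have key : ∀ i ≤ p, ∀ j, ∑ x ∈ U, ((e x : ℚ) / T) *
      ((koszulNumber e (U.erase x) i j : ℚ) * (T / (T - j))) = koszulNumber e U i j := by
    intro i hi j
    have h1 : ∑ x ∈ U, (e x : ℚ) * koszulNumber e (U.erase x) i j =
        (T - j) * koszulNumber e U i j := by
      exact_mod_cast sum_mul_koszulNumber_erase (e := e) U i j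
    have h2 : ∑ x ∈ U, ((e x : ℚ) / T) * ((koszulNumber e (U.erase x) i j : ℚ) * (T / (T - j))) =
        (∑ x ∈ U, (e x : ℚ) * koszulNumber e (U.erase x) i j) / (T - j) := by
      rw [sum_div]
      refine sum_congr rfl fun x _ => ?_
      rw [div_mul_eq_mul_div, div_eq_iff hT0]
      ring
    rw [h2, h1]
    by_cases hj : j = T
    · -- here both sides vanish, the left one because of the division by zero
      rw [hj, hT, koszulNumber_eq_zero_of_sum he (by omega)]
      simp
    · rw [mul_div_cancel_left₀]
      rw [sub_ne_zero]
      exact_mod_cast Ne.symm hj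
  ext i j
  simp only [Finset.sum_apply, Pi.smul_apply, smul_eq_mul]
  change _ = ∑ x ∈ U, ((e x : ℚ) / T) * (if i ≤ p then _ else if i = p + 1 ∧ j = T then _ else _)
  split_ifs with hi hij
  · exact (key i hi j).symm
  · obtain ⟨rfl, rfl⟩ := hij
    have h1 : ∀ x ∈ U, ((e x : ℚ) / T) * ((-1) ^ p * ∑ i ∈ range (p + 1), (-1) ^ i *
        ∑ j ∈ Ico 0 T, (koszulNumber e (U.erase x) i j : ℚ) * ((T : ℚ) / (T - j))) =
        (-1) ^ p * ∑ i ∈ range (p + 1), (-1) ^ i * ∑ j ∈ Ico 0 T, ((e x : ℚ) / T) *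
          ((koszulNumber e (U.erase x) i j : ℚ) * ((T : ℚ) / (T - j))) := by
      intro x _
      simp only [mul_sum]
      exact sum_congr rfl fun i _ => sum_congr rfl fun j _ => by ring
    rw [sum_congr rfl h1, ← mul_sum, sum_comm]
    have h2 : ∀ i ∈ range (p + 1), ∑ x ∈ U, (-1 : ℚ) ^ i * ∑ j ∈ Ico 0 T, ((e x : ℚ) / T) *
        ((koszulNumber e (U.erase x) i j : ℚ) * ((T : ℚ) / (T - j))) =
        (-1) ^ i * ∑ j ∈ Ico 0 T, (koszulNumber e U i j : ℚ) := by
      intro i hi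
      rw [← mul_sum, sum_comm]
      congr 1
      exact sum_congr rfl fun j _ => key i (by have := mem_range.1 hi; omega) j
    have h3 : ∑ i ∈ range (p + 1), (-1 : ℚ) ^ i * ∑ j ∈ Ico 0 T, (koszulNumber e U i j : ℚ) =
        (-1) ^ p := by
      exact_mod_cast alternating_sum_koszulNumber he hU
    rw [sum_congr rfl h2, h3, ← hU, koszulNumber_card, if_pos hT, ← mul_pow]
    norm_num
  · rw [sum_eq_zero fun x _ => mul_zero _]
    by_cases hi' : i = U.card
    · rw [hi', koszulNumber_card, if_neg fun h => hij ⟨hi'.trans hU, h⟩]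
      rfl
    · rw [koszulNumber_of_card_lt (by omega)]
      rfl

lemma koszulNumber_mem_pureCone [DecidableEq α] (he : ∀ a, 0 < e a) (p : ℕ)
    (U : Finset α) (hU : U.card = p) :
    (fun i j => (koszulNumber e U i j : ℚ)) ∈ pureCone p (∑ a ∈ U, e a) := by
  induction p generalizing U with
  | zero =>
    obtain rfl := card_eq_zero.1 hU
    refine Submodule.subset_span ⟨fun _ => 0, fun a b h => by omega, rfl, by simp, ?_⟩
    ext i j
    rw [koszulNumber_empty]
    rcases Nat.eq_zero_or_pos i with rfl | hi
    · rw [pureDiagram_of_lt _ (by omega)]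
      simp [pureEntry, Fin.fin_one_eq_zero]
    · rw [pureDiagram_of_le _ (by omega), if_neg (by omega)]
      rfl
  | succ p ih =>
    rw [koszulNumber_eq_sum_appendDegree he hU]
    have hT : 0 ≤ ∑ a ∈ U, e a := sum_nonneg fun a _ => (he a).le
    refine Submodule.sum_mem _ fun x hx => ?_
    have hw : (0 : ℚ) ≤ (e x : ℚ) / (∑ a ∈ U, e a : ℤ) :=
      div_nonneg (by exact_mod_cast (he x).le) (by exact_mod_cast hT)
    refine Submodule.smul_mem (pureCone (p + 1) _) (⟨_, hw⟩ : ℚ≥0)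
      (appendDegree_mem_pureCone (w := ∑ a ∈ U.erase x, e a) ?_
        (ih (U.erase x) (by rw [card_erase_of_mem hx, hU]; rfl)))
    rw [← add_sum_erase _ _ hx]
    exact lt_add_of_pos_left _ (he x)

end koszul

end CIBetti

theorem theorem4p3 {k : Type*} [Field k] (n p : ℕ) (f : Fin p → MvPolynomial (Fin n) k)
    (hhom : ∀ i, ∃ e : ℕ, (f i).IsHomogeneous e)
    (hreg : RingTheory.Sequence.IsRegular (MvPolynomial (Fin n) k) (List.ofFn f)) :
    Nonempty (CIBetti.MinimalGradedFreeResolution k n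
        (CIBetti.quotientGrading (Ideal.span (Set.range f)))) ∧
      ∀ F : CIBetti.MinimalGradedFreeResolution k n
          (CIBetti.quotientGrading (Ideal.span (Set.range f))),
        CIBetti.IsNonnegCombinationOfPure p (fun i j => (F.bettiNumber i j : ℚ)) := by
  choose e he using hhom
  have hreg' := CIBetti.mul_mem_span_of_isWeaklyRegular hreg.toIsWeaklyRegular
  have hne : Ideal.span (Set.range f) ≠ ⊤ := by
    intro h
    refine hreg.top_ne_smul ?_
    rw [smul_eq_mul, Ideal.mul_top, Ideal.ofList, ← h]
    congr 1
    ext x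
    simp [List.mem_ofFn]
  -- a form of degree zero is a constant: either a unit, or zero, which is not regular
  have hpos : ∀ a, 0 < e a := by
    intro a
    by_contra h0
    have hC := MvPolynomial.totalDegree_eq_zero_iff_eq_C.1
      (Nat.le_zero.1 ((he a).totalDegree_le.trans (not_lt.1 h0)))
    by_cases hc : (f a).coeff 0 = 0
    · rw [hc, map_zero] at hC
      refine hne (Ideal.eq_top_of_isUnit_mem _ (Ideal.span_mono (Set.image_subset_range f _)
        (hreg' a 1 ?_)) isUnit_one)
      rw [hC, zero_mul]
      exact Submodule.zero_mem _
    · refine hne (Ideal.eq_top_of_isUnit_mem _ (Ideal.subset_span ⟨a, rfl⟩) ?_)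
      rw [hC]
      exact (isUnit_iff_ne_zero.2 hc).map MvPolynomial.C
  have hf : ∀ a, f a ∈ CIBetti.component k n (e a) := fun a =>
    CIBetti.mem_component_of_isHomogeneous (he a)
  obtain ⟨K, hK⟩ := CIBetti.exists_resolution_koszul f (fun a => (e a : ℤ)) hf
    (fun a => by exact_mod_cast (hpos a).ne') hreg'
  refine ⟨⟨K⟩, fun F => ?_⟩
  have hℳ := CIBetti.hasHomogeneousLifts_quotientGrading fun j r => CIBetti.proj_mem_span hf j
  simp only [CIBetti.MinimalGradedFreeResolution.bettiNumber_eq hℳ F K, hK]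
  exact CIBetti.isNonnegCombinationOfPure_of_mem_pureCone
    (CIBetti.koszulNumber_mem_pureCone (fun a => by exact_mod_cast hpos a) p Finset.univ (by simp))
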